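/- **Setting.** Let $M$ be a finite abelian group (e.g. $\mathbb{F}^\theta$ for a finite field $\mathbb{F}$) with a distance $d$; let $e_k:\mathcal U\to M$ ($k\in K_e$) be a keyed embedding, $P_k:M\to M$ ($k\in K_P$) a family of permutations, $f_k:M\to\{0,1\}^\lambda$ ($k\in K_f$) a family of functions, with finite non-empty key spaces; let $L\subseteq M$ (possibly depending on the embedding key) and $T\ge 0$, and say that $z\in M$ is *blocked* if $d(z,l)\le T$ for some $l\in L$. Let $H:\{0,1\}^*\to M$ be a random oracle, i.e. its values at distinct strings are independent and uniform; triples in $\mathcal U\times M\times K_e$ are encoded injectively as bit strings. The following functionalities are ideal (secure and correct): * $\mathcal F_{EM}$: on client input $x$ and server input $(k_1,k_2,k_e)$ the client gets $p_1=P_{k_1}(e_{k_e}(x))$, $p_2=P_{k_2}(H(x,e_{k_e}(x),k_e))$ and the server gets nothing. * $\mathcal F_{TC}$: on client input $(p_1,p_2)$ and server input $(L,T,k_1,k_2,k_f)$ put $z=P_{k_1}^{-1}(p_1)$ and $y=z+P_{k_2}^{-1}(p_2)$. If $z$ is not blocked, the client gets $f_{k_f}(y)$ and the server gets $y$; otherwise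 the server aborts and learns $\{l\in L: d(z,l)\le T\}$. * $\mathcal F_{IC}$: on client input $y'$ and server input $(k_f,y)$ the client gets $f_{k_f}(y')$ if $y=y'$ and $\bot$ otherwise; the server always gets $\bot$. **Experiment.** Draw $x\in\mathcal U$ from a given (not necessarily uniform) distribution and $k_1,k_2\in K_P$, $k_f\in K_f$, $k_e\in K_e$ uniformly, all independent. Run $\mathcal F_{EM}$ and $\mathcal F_{TC}$ with the honest client. If the server does not abort, it obtains $y$; then $A_1^{H}(y,k_1,k_2,k_f,k_e)$ outputs a state $\phi$ and a key $k_e'\in K_e$, the client computes $y'=e_{k_e'}(x)+H(x,e_{k_e'}(x),k_e')$, and $A_2^{H,\,\mathcal F_{IC}(y',\cdot)}(k_e',\phi)$ outputs $\hat x$. The server $(A_1,A_2)$ wins if $\hat x=x$. Its advantage is the probability of winning given that the explicit check accepts (i.e. that $e_{k_e}(x)$ is not blocked); its advantage for the known key $k$ is the probability of winning given in addition $k_e=k$. **Guessing probability.** Let $\pi_k(n)$ be the probability of guessing $x$ within $n$ guesses when values are guessed in order of nonincreasing probability under the posterior distribution of $x$ given $k_e=k$ and that $e_k(x)$ is not blocked,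 and let $\pi(n)$ be the mean of $\pi_{k}(n)$ over the posterior distribution of $k=k_e$ given acceptance. **Proposition.** Let $q,q_H\in\mathbb N$, and fix any measure of running time and any bound $t$ on it. 1. Let $\mathrm{Adv}(t,q,q_H)$ be the supremum of the advantages of all adversaries $(A_1,A_2)$ of running time at most $t$, making at most $q$ queries to $\mathcal F_{IC}(y',\cdot)$ and at most $q_H$ queries to $H$ in total, where the evaluation $H(\hat x,e_{k_e}(\hat x),k_e)$ that checks the final guess is counted among the $q_H$ queries (also when the adversary does not make it). Then $\mathrm{Adv}(t,q,q_H)\le\pi(q_H)$, and for each key $k$ the corresponding supremum of the advantages for $k$ is at most $\pi_k(q_H)$. 2. If the check of the final guess is not counted, i.e. if $(A_1,A_2)$ ranges over all adversaries of running time at most $t$ that make at most $q$ queries to $\mathcal F_{IC}(y',\cdot)$ and at most $q_H$ queries of their own to $H$, then the same suprema are at most $\pi(q_H+1)$ and $\pi_k(q_H+1)$. So the server can do no better than a dictionary attack. -/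

import Mathlib

open MeasureTheory
open scoped ENNReal NNReal

noncomputable section

/-- Randomized oracle algorithms with outputs in `α`: an algorithm may draw a sample from any
distribution on `ℕ`, and may query an oracle that answers a query `s : Q` by an element of `R s`.
Internal computation is unrestricted. -/
inductive OracleAlg (Q : Type) (R : Q → Type) (α : Type) : Type
  | ret (a : α) : OracleAlg Q R α
  | sample (p : PMF ℕ) (next : ℕ → OracleAlg Q R α) : OracleAlg Q R α
  | query (s : Q) (next : R s → OracleAlg Q R α) : OracleAlg Q R α

/-- Execution with a fixed oracle: the distribution of the output together with the list of all
queries made, in order. -/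
def OracleAlg.run {Q : Type} {R : Q → Type} {α : Type} (oracle : (s : Q) → R s) :
    OracleAlg Q R α → PMF (α × List Q)
  | .ret a => PMF.pure (a, [])
  | .sample p next => p.bind fun n => (next n).run oracle
  | .query s next => ((next (oracle s)).run oracle).map fun r => (r.1, s :: r.2)

/-- The public parameters of the framework. `U` is the input universe, `M` the metric space
(a finite abelian group, such as `𝔽 ^ θ`), `KP`, `KF`, `KE` are the key spaces of the permutation
family, of the function family and of the embedding, and `ell` is the output length of the
function family. -/
structure Framework (U M KP KF KE : Type) (ell : ℕ) where
  /-- the application-specific (not necessarily uniform) distribution of client inputs -/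
  inputDist : PMF U
  /-- the keyed embedding -/
  embed : KE → U → M
  /-- the keyed permutation family -/
  perm : KP → Equiv.Perm M
  /-- the keyed function family -/
  prf : KF → M → (Fin ell → Bool)
  /-- the unambiguous encoding of triples as bit strings, the arguments of the hash function -/
  encode : U × M × KE → List Bool
  encode_injective : Function.Injective encode
  /-- the server's list of blocked points; it may have been computed with the embedding key -/
  blocklist : KE → Set M
  /-- the distance threshold -/
  threshold : ℝ≥0

/-- What the server learns from Test-and-Commit: the token, or, when it aborts, the list entries
that are close to the embedded input. -/
inductive TestOutput (M : Type) : Type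
  | token (y : M) : TestOutput M
  | abort (near : Set M) : TestOutput M

/-- The queries of the server during the implicit check: to the hash function, and to the
implicit-check functionality, with the server input `(kf, y)`. -/
inductive ServerQuery (M KF : Type) : Type
  | hash (s : List Bool) : ServerQuery M KF
  | implicitCheck (kf : KF) (y : M) : ServerQuery M KF

/-- The types of answers: a hash value, or nothing (the server output `⊥`). -/
def ServerQuery.Answer {M KF : Type} : ServerQuery M KF → Type
  | .hash _ => M
  | .implicitCheck _ _ => Unit

def ServerQuery.hashString? {M KF : Type} : ServerQuery M KF → Option (List Bool)
  | .hash s => some s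
  | .implicitCheck _ _ => none

/-- A server adversary. The first stage sees the token and all keys, may query the hash function,
and outputs a state and an embedding key to be sent to the client; the second stage continues from
there with access to the hash function and to the implicit check against the client, and outputs
a guess of the client input. -/
structure ServerAdversary (U M KP KF KE : Type) where
  State : Type
  first : M → KP → KP → KF → KE → OracleAlg (List Bool) (fun _ => M) (State × KE)
  second : KE → State → OracleAlg (ServerQuery M KF) ServerQuery.Answer U

/-- The record of one execution of the experiment. When the server aborts in the explicit check,
`accepted` is `false` and no guess is made. -/
structure ServerTranscript (U KE : Type) where
  input : U
  embedKey : KE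
  accepted : Bool
  /-- all hash queries of both stages of the adversary -/
  hashQueries : List (List Bool)
  /-- the number of implicit-check queries of the second stage -/
  icQueries : ℕ
  guess : Option U

/-- The experiment returns `1`: the guess is the client input. -/
def ServerTranscript.Wins {U KE : Type} (r : ServerTranscript U KE) : Prop :=
  r.guess = some r.input

/-- The random oracle: the values at distinct bit strings are independent and uniform in `M`. -/
def randomOracle (M : Type) [Fintype M] [Nonempty M] [MeasurableSpace M] :
    Measure (List Bool → M) :=
  Measure.infinitePi fun _ => (PMF.uniformOfFintype M).toMeasure

open Classical in
/-- The set of the first `n` guesses when guessing in order of nonincreasing weight: the next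
guess is always a value of largest weight among those not guessed yet, as long as there is one. -/
def greedyGuesses {U : Type} (p : U → ℝ≥0∞) : ℕ → Finset U
  | 0 => ∅
  | n + 1 =>
    if h : ∃ u, u ∉ greedyGuesses p n ∧ ∀ v, v ∉ greedyGuesses p n → p v ≤ p u then
      insert h.choose (greedyGuesses p n)
    else greedyGuesses p n

/-- The probability of guessing a value with distribution `p` within `n` guesses made in order of
nonincreasing probability. -/
def greedyGuessProb {U : Type} (p : U → ℝ≥0∞) (n : ℕ) : ℝ≥0∞ :=
  ∑ u ∈ greedyGuesses p n, p u

namespace Framework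

variable {U M KP KF KE : Type} {ell : ℕ} [AddCommGroup M] [PseudoMetricSpace M]
  (Φ : Framework U M KP KF KE ell)

/-- The point `z` is within the threshold of a list entry. -/
def Blocked (ke : KE) (z : M) : Prop :=
  ∃ l ∈ Φ.blocklist ke, dist z l ≤ (Φ.threshold : ℝ)

/-- The bit string that is hashed for the input `x` under the embedding key `ke`. -/
def hashInput (ke : KE) (x : U) : List Bool :=
  Φ.encode (x, Φ.embed ke x, ke)

/-- Embed-and-Map with client input `x` and server input `(k₁, k₂, ke)`: client output and server
output. -/
def embedAndMap (H : List Bool → M) (x : U) (k₁ k₂ : KP) (ke : KE) : (M × M) × Unit :=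
  ((Φ.perm k₁ (Φ.embed ke x), Φ.perm k₂ (H (Φ.hashInput ke x))), ())

open Classical in
/-- Test-and-Commit with client input `(p₁, p₂)` and server input `(k₁, k₂, kf)` and the list and
threshold: client output (`none` is `⊥`) and server output. -/
def testAndCommit (ke : KE) (p₁ p₂ : M) (k₁ k₂ : KP) (kf : KF) :
    Option (Fin ell → Bool) × TestOutput M :=
  let z := (Φ.perm k₁).symm p₁
  let y := z + (Φ.perm k₂).symm p₂
  if Φ.Blocked ke z then
    (none, .abort {l ∈ Φ.blocklist ke | dist z l ≤ (Φ.threshold : ℝ)})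
  else (some (Φ.prf kf y), .token y)

open Classical in
/-- Implicit check with client input `y'` and server input `(kf, y)`: client output (`none` is
`⊥`) and server output (always `⊥`). -/
def implicitCheck (y' : M) (kf : KF) (y : M) : Option (Fin ell → Bool) × Unit :=
  (if y = y' then some (Φ.prf kf y') else none, ())

/-- The oracles of the second stage, when the client input to the implicit check is `y'`. -/
def secondOracle (H : List Bool → M) (y' : M) : (s : ServerQuery M KF) → s.Answer
  | .hash s => H s
  | .implicitCheck kf y => (Φ.implicitCheck y' kf y).2

variable [Fintype KP] [Nonempty KP] [Fintype KF] [Nonempty KF] [Fintype KE] [Nonempty KE]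

/-- The experiment of the server adversary `A`, for a fixed hash function `H`. -/
def serverExperiment (H : List Bool → M) (A : ServerAdversary U M KP KF KE) :
    PMF (ServerTranscript U KE) := do
  let x ← Φ.inputDist
  let k₁ ← PMF.uniformOfFintype KP
  let k₂ ← PMF.uniformOfFintype KP
  let kf ← PMF.uniformOfFintype KF
  let ke ← PMF.uniformOfFintype KE
  let p := (Φ.embedAndMap H x k₁ k₂ ke).1
  match (Φ.testAndCommit ke p.1 p.2 k₁ k₂ kf).2 with
  | .abort _ => PMF.pure ⟨x, ke, false, [], 0, none⟩
  | .token y => do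
    let ((st, ke'), log₁) ← (A.first y k₁ k₂ kf ke).run H
    let y' := Φ.embed ke' x + H (Φ.hashInput ke' x)
    let (guess, log₂) ← (A.second ke' st).run (Φ.secondOracle H y')
    let hashLog₂ := log₂.filterMap ServerQuery.hashString?
    PMF.pure ⟨x, ke, true, log₁ ++ hashLog₂, log₂.length - hashLog₂.length, some guess⟩

open Classical in
/-- The number of hash evaluations charged to the adversary when the evaluation that checks the
final guess against the token is counted too (once, if the adversary has made it already). -/
def chargedHashQueries (r : ServerTranscript U KE) : ℕ :=
  match r.guess with
  | none => r.hashQueries.length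
  | some u =>
    if Φ.hashInput r.embedKey u ∈ r.hashQueries then r.hashQueries.length
    else r.hashQueries.length + 1

/-- Every execution of the experiment has at most `q` implicit-check queries and at most `qH`
hash queries, the check of the final guess included. -/
def ChargedBound (q qH : ℕ) (A : ServerAdversary U M KP KF KE) : Prop :=
  ∀ H : List Bool → M, ∀ r ∈ (Φ.serverExperiment H A).support,
    r.icQueries ≤ q ∧ Φ.chargedHashQueries r ≤ qH

/-- Every execution of the experiment has at most `q` implicit-check queries and at most `qH`
explicit hash queries of the adversary; the final guess is free. -/
def ExplicitBound (q qH : ℕ) (A : ServerAdversary U M KP KF KE) : Prop :=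
  ∀ H : List Bool → M, ∀ r ∈ (Φ.serverExperiment H A).support,
    r.icQueries ≤ q ∧ r.hashQueries.length ≤ qH

/-- The probability that the client input, drawn from the input distribution, passes the test for
the embedding key `ke`. -/
def acceptProb (ke : KE) : ℝ≥0∞ :=
  Φ.inputDist.toOuterMeasure {u | ¬ Φ.Blocked ke (Φ.embed ke u)}

open Classical in
/-- The posterior distribution of the client input for the known embedding key `ke`, after
observing that the input passed the test. -/
def posterior (ke : KE) (u : U) : ℝ≥0∞ :=
  (if Φ.Blocked ke (Φ.embed ke u) then 0 else Φ.inputDist u) / Φ.acceptProb ke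

/-- The probability of guessing the client input within `n` guesses, for the known key `ke`. -/
def guessProbAt (ke : KE) (n : ℕ) : ℝ≥0∞ :=
  greedyGuessProb (Φ.posterior ke) n

/-- The probability of guessing the client input within `n` guesses that are made with knowledge of
the embedding key: the mean of `guessProbAt ke n` over the posterior distribution of the (a priori
uniform) key `ke`. -/
def guessProb (n : ℕ) : ℝ≥0∞ :=
  ∑ ke : KE, (Φ.acceptProb ke / ∑ ke' : KE, Φ.acceptProb ke') * Φ.guessProbAt ke n

variable [Fintype M] [MeasurableSpace M]

/-- The probability of an event in the experiment, over the random oracle and all other coins. -/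
def prob (A : ServerAdversary U M KP KF KE) (E : Set (ServerTranscript U KE)) : ℝ≥0∞ :=
  ∫⁻ H, (Φ.serverExperiment H A).toOuterMeasure E ∂(randomOracle M)

/-- The success probability, given that the explicit check has accepted. -/
def winProb (A : ServerAdversary U M KP KF KE) : ℝ≥0∞ :=
  Φ.prob A {r | r.Wins ∧ r.accepted = true} / Φ.prob A {r | r.accepted = true}

/-- The success probability, given that the explicit check has accepted and that the embedding key
is `ke`. -/
def winProbAt (ke : KE) (A : ServerAdversary U M KP KF KE) : ℝ≥0∞ :=
  Φ.prob A {r | r.Wins ∧ r.accepted = true ∧ r.embedKey = ke} /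
    Φ.prob A {r | r.accepted = true ∧ r.embedKey = ke}

/-- The maximal advantage of the adversaries in a class. -/
def advantage (C : Set (ServerAdversary U M KP KF KE)) : ℝ≥0∞ :=
  ⨆ A ∈ C, Φ.winProb A

/-- The maximal advantage of the adversaries in a class, for the known embedding key `ke`. -/
def advantageAt (ke : KE) (C : Set (ServerAdversary U M KP KF KE)) : ℝ≥0∞ :=
  ⨆ A ∈ C, Φ.winProbAt ke A

end Framework

end

/-! ### Optimality of greedy guessing -/

/-! The token is a one-time pad. Fix the keys and write `s x` for the hash input of `x` and `e x`
for its embedding. Since the hash value at `s x` is uniform and independent of the rest, one may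
draw the token `y` uniformly, draw a random oracle `G`, and run the server with `G` overwritten at
`s x` by `y - e x` (`lintegral_randomOracle_resample`). Now `y` and `G` are independent of `x`, and
the secret shows only through the answer at the single point `s x`. The implicit check returns
nothing to the server, so its queries can be deleted and both stages merged into one hash-only
algorithm.

For such an algorithm, a query `s u` separates at most the one candidate `u` from the others.
Induction on the algorithm charges the weight of `u` to that query and continues with `u` removed
(`OracleAlg.tsum_run_le_bestGuessWeight`). The success weight is thus at most the weight of some set
of `n` inputs, and greedy guessing attains the best such set (`sum_le_greedyGuessProb`).

Averaging over the keys and dividing by the acceptance probability gives the bounds. Both ways of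
counting queries enter through `GuessBound`, with `n = qH` or `n = qH + 1`. -/

/-- A summable weight exceeds a given positive level only finitely often, so the maximum is attained
even for infinite `U`. Hence greedy guessing stalls only when every value has been guessed. -/
theorem exists_max_notMem_of_tsum_ne_top {U : Type} {p : U → ℝ≥0∞} (hp : ∑' u, p u ≠ ∞)
    (S : Finset U) {v : U} (hv : v ∉ S) : ∃ u, u ∉ S ∧ ∀ v, v ∉ S → p v ≤ p u := by
  by_cases hzero : ∀ u, u ∉ S → p u = 0
  · exact ⟨v, hv, fun u hu => by simp [hzero u hu]⟩
  push Not at hzero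
  obtain ⟨u₀, hu₀, hpos⟩ := hzero
  have hfin : {u | p u₀ ≤ p u}.Finite := ENNReal.finite_const_le_of_tsum_ne_top hp hpos
  obtain ⟨u, ⟨hu, hge⟩, hmax⟩ := Set.exists_max_image ({u | p u₀ ≤ p u} \ S) p
    (hfin.subset Set.sdiff_subset) ⟨u₀, show p u₀ ≤ p u₀ from le_rfl, hu₀⟩
  refine ⟨u, hge, fun w hw => ?_⟩
  rcases le_total (p u₀) (p w) with h | h
  · exact hmax w ⟨h, hw⟩
  · exact h.trans hu

/-- Exchange argument: if `v ∈ S` has not been guessed after `n` steps, the next greedy guess weighs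
at least `p v`, and induction handles `S` without `v`. -/
theorem sum_le_greedyGuessProb {U : Type} {p : U → ℝ≥0∞} (hp : ∑' u, p u ≠ ∞) :
    ∀ (n : ℕ) (S : Finset U), S.card ≤ n → ∑ u ∈ S, p u ≤ greedyGuessProb p n := by
  classical
  intro n
  induction n with
  | zero =>
    intro S hS
    simp [Finset.card_eq_zero.mp (Nat.le_zero.mp hS)]
  | succ n ih =>
    intro S hS
    by_cases hsub : S ⊆ greedyGuesses p n
    · refine (Finset.sum_le_sum_of_subset hsub).trans (Finset.sum_le_sum_of_subset ?_)
      rw [greedyGuesses]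
      split_ifs
      · exact Finset.subset_insert _ _
      · exact subset_rfl
    · obtain ⟨v, hvS, hv⟩ := Finset.not_subset.mp hsub
      have h := exists_max_notMem_of_tsum_ne_top hp _ hv
      rw [greedyGuessProb, greedyGuesses, dif_pos h, Finset.sum_insert h.choose_spec.1,
        ← Finset.add_sum_erase S p hvS]
      refine add_le_add (h.choose_spec.2 v hv) (ih _ ?_)
      rw [Finset.card_erase_of_mem hvS]
      omega

/-- The largest weight of a set of at most `n` elements. -/
noncomputable def bestGuessWeight {U : Type} (w : U → ℝ≥0∞) (n : ℕ) : ℝ≥0∞ :=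
  ⨆ (S : Finset U) (_ : S.card ≤ n), ∑ u ∈ S, w u

theorem sum_le_bestGuessWeight {U : Type} (w : U → ℝ≥0∞) {n : ℕ} {S : Finset U}
    (hS : S.card ≤ n) : ∑ u ∈ S, w u ≤ bestGuessWeight w n :=
  le_iSup₂_of_le S hS le_rfl

/-- Once `u` has weight zero, a set may drop it for free; putting it back at full weight costs one
more element. This is the accounting for one hash query. -/
theorem add_bestGuessWeight_update_le {U : Type} [DecidableEq U] (w : U → ℝ≥0∞) (n : ℕ) (u : U) :
    w u + bestGuessWeight (Function.update w u 0) n ≤ bestGuessWeight w (n + 1) := by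
  unfold bestGuessWeight
  rw [ENNReal.add_biSup' (p := fun S : Finset U => S.card ≤ n) ⟨∅, by simp⟩]
  refine iSup₂_le fun S hS => ?_
  have : ∑ x ∈ S, Function.update w u 0 x ≤ ∑ x ∈ S.erase u, w x := by
    by_cases hu : u ∈ S
    · rw [← Finset.add_sum_erase S _ hu, Function.update_self, zero_add]
      exact Finset.sum_le_sum fun x hx => by
        rw [Function.update_of_ne (Finset.ne_of_mem_erase hx)]
    · rw [Finset.erase_eq_of_notMem hu]
      exact Finset.sum_le_sum fun x hx => by
        rw [Function.update_of_ne (ne_of_mem_of_not_mem hx hu)]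
  calc _ ≤ w u + ∑ x ∈ S.erase u, w x := by gcongr
    _ = ∑ x ∈ insert u (S.erase u), w x := by rw [Finset.sum_insert (by simp)]
    _ ≤ _ := sum_le_bestGuessWeight w <| (Finset.card_insert_le _ _).trans <|
      Nat.succ_le_succ <| (Finset.card_erase_le).trans hS

/-! ### Oracle algorithms -/

theorem PMF.toOuterMeasure_apply_le_one {α : Type*} (p : PMF α) (s : Set α) :
    p.toOuterMeasure s ≤ 1 := by
  rw [← (p.toOuterMeasure_apply_eq_one_iff (s := Set.univ)).2 (Set.subset_univ _)]
  exact measure_mono (Set.subset_univ s)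

namespace OracleAlg

/-- Sequential composition. -/
def bind {Q : Type} {R : Q → Type} {α β : Type} (a : OracleAlg Q R α)
    (f : α → OracleAlg Q R β) : OracleAlg Q R β :=
  match a with
  | .ret a => f a
  | .sample p next => .sample p fun n => (next n).bind f
  | .query s next => .query s fun r => (next r).bind f

theorem run_bind {Q : Type} {R : Q → Type} {α β : Type} (o : (s : Q) → R s)
    (a : OracleAlg Q R α) (f : α → OracleAlg Q R β) :
    (a.bind f).run o =
      (a.run o).bind fun r => ((f r.1).run o).map fun r' => (r'.1, r.2 ++ r'.2) := by
  induction a with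
  | ret a =>
    simp only [bind, run, PMF.pure_bind, List.nil_append]
    exact (PMF.map_id _).symm
  | sample p next ih => simp [bind, run, ih, PMF.bind_bind]
  | query s next ih =>
    simp [bind, run, ih, PMF.map_bind, PMF.bind_map, PMF.map_comp, Function.comp_def]

/-- Removal of the implicit-check queries, whose answers are trivial. -/
def hashOnly {M KF α : Type} :
    OracleAlg (ServerQuery M KF) ServerQuery.Answer α → OracleAlg (List Bool) (fun _ => M) α
  | .ret a => .ret a
  | .sample p next => .sample p fun n => (next n).hashOnly
  | .query (.hash s) next => .query s fun m => (next m).hashOnly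
  | .query (.implicitCheck _ _) next => (next ()).hashOnly

/-- Only the hash answers of `o` matter, so the client's value `y'`, and with it the key sent to the
client, drops out of the analysis. -/
theorem run_hashOnly {M KF α : Type} (H : List Bool → M)
    (o : (s : ServerQuery M KF) → s.Answer) (ho : ∀ s, o (.hash s) = H s)
    (a : OracleAlg (ServerQuery M KF) ServerQuery.Answer α) :
    a.hashOnly.run H =
      (a.run o).map fun r => (r.1, r.2.filterMap ServerQuery.hashString?) := by
  induction a with
  | ret a => simp [hashOnly, run, PMF.pure_map]
  | sample p next ih => simp [hashOnly, run, ih, PMF.map_bind]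
  | query s next ih =>
    cases s with
    | hash s =>
      have h := ih (H s)
      simp [hashOnly, run, h, ho, PMF.map_comp, Function.comp_def, ServerQuery.hashString?]
    | implicitCheck kf y =>
      rw [run, PMF.map_comp]
      exact ih ()

theorem measurable_run_toOuterMeasure {Q M α : Type} [Countable M] [MeasurableSpace M]
    [MeasurableSingletonClass M] (a : OracleAlg Q (fun _ => M) α) (T : Set (α × List Q)) :
    Measurable fun H : Q → M => (a.run H).toOuterMeasure T := by
  induction a generalizing T with
  | ret a => simp only [run, measurable_const]
  | sample p next ih =>
    simp only [run, PMF.toOuterMeasure_bind_apply]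
    exact Measurable.tsum fun n => (ih n T).const_mul _
  | query s next ih =>
    simp only [run, PMF.toOuterMeasure_map_apply]
    -- The continuation depends on the answer, which depends on `H`. Both are separated into
    -- independent arguments, which is harmless because `M` is countable, and then recombined.
    have h : Measurable fun z : (Q → M) × M =>
        ((next z.2).run z.1).toOuterMeasure ((fun r => (r.1, s :: r.2)) ⁻¹' T) :=
      measurable_from_prod_countable_left fun m => ih m _
    exact h.comp (measurable_id.prodMk (measurable_pi_apply s))

/-- A dictionary attack is optimal: the answer at `s x` depends on the secret `x`, and the other
answers do not. If the algorithm makes at most `n` queries, and fewer than `n` when it returns the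
secret `x` without querying `s x`, then its success weight is that of at most `n` guesses. -/
theorem tsum_run_le_bestGuessWeight {Q U : Type} {R : Q → Type} [DecidableEq Q] {s : U → Q}
    (hs : Function.Injective s) (G : (t : Q) → R t) (c : (x : U) → R (s x))
    (a : OracleAlg Q R U) (w : U → ℝ≥0∞) (n : ℕ)
    (hn : ∀ x, w x ≠ 0 → ∀ r ∈ (a.run (Function.update G (s x) (c x))).support,
      r.2.length ≤ n ∧ (r.1 = x → s x ∉ r.2 → r.2.length < n)) :
    ∑' x, w x * (a.run (Function.update G (s x) (c x))).toOuterMeasure {r | r.1 = x} ≤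
      bestGuessWeight w n := by
  classical
  induction a generalizing w n with
  | ret u =>
    simp only [run, PMF.support_pure, Set.mem_singleton_iff, forall_eq] at hn ⊢
    rw [tsum_eq_single u fun x hx => by
      simp [PMF.toOuterMeasure_pure_apply, Ne.symm hx]]
    by_cases hu : w u = 0
    · simp [hu]
    -- No query has been made, so a correct guess `u` is an unchecked one, for which the hypothesis
    -- reserves one unit.
    · have : 0 < n := (hn u hu).2 rfl (by simp)
      calc _ ≤ w u := mul_le_of_le_one_right' (PMF.toOuterMeasure_apply_le_one _ _)
        _ = ∑ x ∈ {u}, w x := by simp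
        _ ≤ _ := sum_le_bestGuessWeight w (by simpa [Nat.one_le_iff_ne_zero, Nat.pos_iff_ne_zero] using this)
  | sample p next ih =>
    simp only [run, PMF.toOuterMeasure_bind_apply, ← ENNReal.tsum_mul_left] at hn ⊢
    rw [ENNReal.tsum_comm]
    calc _ ≤ ∑' k, p k * bestGuessWeight w n := by
          refine ENNReal.tsum_le_tsum fun k => ?_
          by_cases hk : p k = 0
          · simp [hk]
          simp only [mul_left_comm _ (p k), ENNReal.tsum_mul_left]
          gcongr
          refine ih k w n fun x hx r hr => hn x hx r ?_
          rw [PMF.mem_support_bind_iff]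
          exact ⟨k, hk, hr⟩
      _ = _ := by rw [ENNReal.tsum_mul_right, p.tsum_coe, one_mul]
  | query t next ih =>
    simp only [run, PMF.toOuterMeasure_map_apply, PMF.mem_support_map_iff, Set.preimage_ofPred_eq,
      forall_exists_index, and_imp, forall_apply_eq_imp_iff₂, List.length_cons,
      List.mem_cons, not_or, and_imp] at hn ⊢
    -- By injectivity of `s`, the query tests at most one candidate that is still alive.
    by_cases hu : ∃ u, s u = t ∧ w u ≠ 0
    · obtain ⟨u, rfl, hwu⟩ := hu
      -- Any possible run witnesses that the current query is counted, whence `n ≥ 1`.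
      obtain ⟨r₀, hr₀⟩ := ((next (Function.update G (s u) (c u) (s u))).run
        (Function.update G (s u) (c u))).support_nonempty
      obtain ⟨m, rfl⟩ : ∃ m, n = m + 1 :=
        Nat.exists_eq_add_of_lt (Nat.lt_of_lt_of_le (Nat.succ_pos _) (hn u hwu r₀ hr₀).1) |>.imp
          fun m hm => by omega
      refine le_trans ?_ (add_bestGuessWeight_update_le w m u)
      -- The secret `u` is conceded entirely. Every other secret sees the same answer `G (s u)`, so
      -- induction applies with `u` erased and one query fewer; the bound `hn` is only needed where
      -- the weight is nonzero, which lets it survive the erasure.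
      rw [ENNReal.tsum_eq_add_tsum_ite u]
      gcongr
      · exact mul_le_of_le_one_right' (PMF.toOuterMeasure_apply_le_one _ _)
      · refine le_trans (ENNReal.tsum_le_tsum fun x => ?_)
          (ih (G (s u)) (Function.update w u 0) m fun x hx r hr => ?_)
        · split_ifs with hx
          · simp
          · rw [Function.update_of_ne hx, Function.update_of_ne (hs.ne (Ne.symm hx))]
        · have hxu : x ≠ u := fun h => hx (by simp [h])
          rw [Function.update_of_ne hxu] at hx
          have := hn x hx r (by rwa [Function.update_of_ne (hs.ne hxu.symm)])
          exact ⟨by omega, fun h1 h2 => by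
            have := this.2 h1 (hs.ne hxu) h2
            omega⟩
    -- The query hits no live candidate: its answer is `G t` for all of them, and nothing is
    -- learned.
    · have hne : ∀ x, w x ≠ 0 → t ≠ s x := fun x hx h => hu ⟨x, h.symm, hx⟩
      refine le_trans (ENNReal.tsum_le_tsum fun x => ?_) (ih (G t) w n fun x hx r hr => ?_)
      · by_cases hx : w x = 0
        · simp [hx]
        · rw [Function.update_of_ne (hne x hx)]
      · have := hn x hx r (by rwa [Function.update_of_ne (hne x hx)])
        exact ⟨by omega, fun h1 h2 => by
          have := this.2 h1 (hne x hx).symm h2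
          omega⟩

end OracleAlg

/-! ### The random oracle -/

/-- The coordinates are independent, so one of them may be replaced by a fresh uniform value. On
finite boxes, the factor at `s` then comes from the fresh value, or is absent. -/
theorem map_update_randomOracle {M : Type} [Fintype M] [Nonempty M] [MeasurableSpace M]
    (s : List Bool) :
    (((PMF.uniformOfFintype M).toMeasure.prod (randomOracle M)).map
      fun z => Function.update z.2 s z.1) = randomOracle M := by
  have hmeas : Measurable fun z : M × (List Bool → M) => Function.update z.2 s z.1 := by
    fun_prop
  have : IsProbabilityMeasure (randomOracle M) := by unfold randomOracle; infer_instance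
  refine Measure.eq_infinitePi _ fun S t ht => ?_
  rw [Measure.map_apply hmeas (.pi S.countable_toSet fun i _ => ht i)]
  by_cases hsS : s ∈ S
  · have : (fun z : M × (List Bool → M) => Function.update z.2 s z.1) ⁻¹' Set.pi S t =
        t s ×ˢ Set.pi (S.erase s : Finset (List Bool)) t := by
      ext z
      simp only [Set.mem_preimage, Set.mem_pi, Set.mem_prod, Finset.mem_coe, Finset.mem_erase]
      constructor
      · refine fun h => ⟨by simpa using h s hsS, fun i hi => ?_⟩
        simpa [hi.1] using h i hi.2
      · rintro ⟨h1, h2⟩ i hi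
        by_cases his : i = s
        · subst his; simpa using h1
        · simpa [his] using h2 i ⟨his, hi⟩
    rw [this, Measure.prod_prod, randomOracle, Measure.infinitePi_pi _ fun i _ => ht i,
      Finset.mul_prod_erase S (fun i => (PMF.uniformOfFintype M).toMeasure (t i)) hsS]
  · have : (fun z : M × (List Bool → M) => Function.update z.2 s z.1) ⁻¹' Set.pi S t =
        Set.univ ×ˢ Set.pi S t := by
      ext z
      simp only [Set.mem_preimage, Set.mem_pi, Set.mem_prod, Finset.mem_coe, Set.mem_univ,
        true_and]
      refine forall₂_congr fun i hi => ?_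
      rw [Function.update_of_ne (fun h : i = s => hsS (h ▸ hi))]
    rw [this, Measure.prod_prod, randomOracle, Measure.infinitePi_pi _ fun i _ => ht i,
      measure_univ, one_mul]

/-- Resampling one value of the random oracle, as a translate of a uniform element `y`. -/
theorem lintegral_randomOracle_resample {M : Type} [AddCommGroup M] [Fintype M]
    [MeasurableSpace M] [DiscreteMeasurableSpace M] (s : List Bool) (e : M)
    {f : M → (List Bool → M) → ℝ≥0∞} (hf : ∀ y, Measurable (f y)) :
    ∫⁻ H, f (e + H s) H ∂(randomOracle M) =
      ∑ y, PMF.uniformOfFintype M y *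
        ∫⁻ G, f y (Function.update G s (y - e)) ∂(randomOracle M) := by
  have : IsProbabilityMeasure (randomOracle M) := by unfold randomOracle; infer_instance
  have hmeas : Measurable fun z : M × (List Bool → M) => Function.update z.2 s z.1 := by
    fun_prop
  have hf' : Measurable fun z : M × (List Bool → M) => f z.1 z.2 :=
    measurable_from_prod_countable_right hf
  have hg : Measurable fun H : List Bool → M => f (e + H s) H :=
    hf'.comp (((measurable_of_countable fun m => e + m).comp (measurable_pi_apply s)).prodMk
      measurable_id)
  conv_lhs => rw [← map_update_randomOracle s]
  have hgm : Measurable fun z : M × (List Bool → M) =>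
      f (e + Function.update z.2 s z.1 s) (Function.update z.2 s z.1) := hg.comp hmeas
  -- The fresh value is written as `y - e`; translation permutes `M`, so `y` is uniform too.
  rw [lintegral_map hg hmeas, lintegral_prod _ hgm.aemeasurable,
    lintegral_fintype, ← Equiv.sum_comp (Equiv.subRight e)]
  refine Finset.sum_congr rfl fun y _ => ?_
  rw [PMF.toMeasure_apply_singleton _ _ (MeasurableSet.singleton _), mul_comm]
  simp

set_option linter.unusedSectionVars false
noncomputable section

/-! ### The server experiment -/

/-- Both stages of the adversary as one algorithm that queries the hash function only. -/
def ServerAdversary.combined {U M KP KF KE : Type} (A : ServerAdversary U M KP KF KE) (y : M)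
    (k : KP × KP × KF) (ke : KE) : OracleAlg (List Bool) (fun _ => M) U :=
  (A.first y k.1 k.2.1 k.2.2 ke).bind fun r => (A.second r.2 r.1).hashOnly

namespace Framework

variable {U M KP KF KE : Type} {ell : ℕ} [AddCommGroup M] [PseudoMetricSpace M]
  (Φ : Framework U M KP KF KE ell)

/-- The client's token. -/
def token (H : List Bool → M) (ke : KE) (x : U) : M :=
  Φ.embed ke x + H (Φ.hashInput ke x)

theorem hashInput_injective (ke : KE) : Function.Injective (Φ.hashInput ke) := fun _ _ h =>
  congrArg Prod.fst (Φ.encode_injective h)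

/-- Inputs inject into bit strings; countability permits exchanging sums over inputs with the oracle
integral. -/
theorem countable_input (Φ : Framework U M KP KF KE ell) [Nonempty KE] : Countable U :=
  (Φ.hashInput_injective (Classical.arbitrary KE)).countable

/-- The part of the experiment after acceptance. -/
def guessPhase (H : List Bool → M) (A : ServerAdversary U M KP KF KE) (ke : KE)
    (k : KP × KP × KF) (x : U) : PMF (ServerTranscript U KE) :=
  ((A.first (Φ.token H ke x) k.1 k.2.1 k.2.2 ke).run H).bind fun r =>
    ((A.second r.1.2 r.1.1).run (Φ.secondOracle H (Φ.token H r.1.2 x))).map fun r' =>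
      ⟨x, ke, true, r.2 ++ r'.2.filterMap ServerQuery.hashString?,
        r'.2.length - (r'.2.filterMap ServerQuery.hashString?).length, some r'.1⟩

open Classical in
/-- The experiment for fixed client input and keys. -/
def trial (H : List Bool → M) (A : ServerAdversary U M KP KF KE) (ke : KE)
    (k : KP × KP × KF) (x : U) : PMF (ServerTranscript U KE) :=
  if Φ.Blocked ke (Φ.embed ke x) then PMF.pure ⟨x, ke, false, [], 0, none⟩
  else Φ.guessPhase H A ke k x

/-- The projection omits `icQueries`, the one field that `hashOnly` forgets. The events and
hash-query counts considered below are determined by the other fields. -/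
theorem map_guessPhase (H : List Bool → M) (A : ServerAdversary U M KP KF KE) (ke : KE)
    (k : KP × KP × KF) (x : U) :
    (Φ.guessPhase H A ke k x).map
        (fun t => (t.input, t.embedKey, t.accepted, t.hashQueries, t.guess)) =
      ((A.combined (Φ.token H ke x) k ke).run H).map fun r => (x, ke, true, r.2, some r.1) := by
  rw [ServerAdversary.combined, OracleAlg.run_bind, guessPhase, PMF.map_bind, PMF.map_bind]
  congr 1
  funext r
  rw [OracleAlg.run_hashOnly H (Φ.secondOracle H (Φ.token H r.1.2 x)) (fun _ => rfl),
    PMF.map_comp, PMF.map_comp, PMF.map_comp]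
  rfl

/-- The accepting executions with embedding key in `K`. -/
def acceptEvent (U : Type) {KE : Type} (K : Set KE) : Set (ServerTranscript U KE) :=
  {r | r.accepted = true ∧ r.embedKey ∈ K}

/-- The winning executions with embedding key in `K`. -/
def winEvent (U : Type) {KE : Type} (K : Set KE) : Set (ServerTranscript U KE) :=
  {r | r.Wins ∧ r.accepted = true ∧ r.embedKey ∈ K}

open Classical in
theorem trial_acceptEvent (H : List Bool → M) (A : ServerAdversary U M KP KF KE) (ke : KE)
    (k : KP × KP × KF) (x : U) (K : Set KE) :
    (Φ.trial H A ke k x).toOuterMeasure (acceptEvent U K) =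
      if Φ.Blocked ke (Φ.embed ke x) then 0 else if ke ∈ K then 1 else 0 := by
  unfold trial
  split_ifs with hb hk
  · simp [acceptEvent, PMF.toOuterMeasure_pure_apply]
  all_goals
    have h := congrArg (fun p => PMF.toOuterMeasure p {z | z.2.2.1 = true ∧ z.2.1 ∈ K})
      (Φ.map_guessPhase H A ke k x)
    simp only [PMF.toOuterMeasure_map_apply, Set.preimage_ofPred_eq, hk] at h
    refine h.trans ?_
  · simpa using (PMF.toOuterMeasure_apply_eq_one_iff _ (s := Set.univ)).2 (Set.subset_univ _)
  · simp

open Classical in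
theorem trial_winEvent (H : List Bool → M) (A : ServerAdversary U M KP KF KE) (ke : KE)
    (k : KP × KP × KF) (x : U) (K : Set KE) :
    (Φ.trial H A ke k x).toOuterMeasure (winEvent U K) =
      if Φ.Blocked ke (Φ.embed ke x) then 0 else if ke ∈ K then
        ((A.combined (Φ.token H ke x) k ke).run H).toOuterMeasure {r | r.1 = x} else 0 := by
  unfold trial
  split_ifs with hb hk
  · simp [winEvent, PMF.toOuterMeasure_pure_apply]
  all_goals
    have h := congrArg (fun p => PMF.toOuterMeasure p
        {z | z.2.2.2.2 = some z.1 ∧ z.2.2.1 = true ∧ z.2.1 ∈ K})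
      (Φ.map_guessPhase H A ke k x)
    simp only [PMF.toOuterMeasure_map_apply, Set.preimage_ofPred_eq, hk] at h
    refine h.trans ?_
    simp

/-- This carries query bounds, which speak of transcripts, over to runs of the combined algorithm.
-/
theorem exists_mem_support_trial {H : List Bool → M} {A : ServerAdversary U M KP KF KE} {ke : KE}
    {k : KP × KP × KF} {x : U} (hx : ¬ Φ.Blocked ke (Φ.embed ke x))
    {r : U × List (List Bool)}
    (hr : r ∈ ((A.combined (Φ.token H ke x) k ke).run H).support) :
    ∃ t ∈ (Φ.trial H A ke k x).support,
      t.embedKey = ke ∧ t.hashQueries = r.2 ∧ t.guess = some r.1 := by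
  have h : (x, ke, true, r.2, some r.1) ∈ ((Φ.guessPhase H A ke k x).map
      (fun t => (t.input, t.embedKey, t.accepted, t.hashQueries, t.guess))).support := by
    rw [map_guessPhase, PMF.mem_support_map_iff]
    exact ⟨r, hr, rfl⟩
  rw [PMF.mem_support_map_iff] at h
  obtain ⟨t, ht, he⟩ := h
  simp only [Prod.mk.injEq] at he
  exact ⟨t, by rwa [trial, if_neg hx], he.2.1, he.2.2.2.1, he.2.2.2.2⟩

variable [Fintype KP] [Nonempty KP] [Fintype KF] [Nonempty KF] [Fintype KE] [Nonempty KE]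

/-- The distribution of the keys of the permutations and of the function. -/
def keyDist (KP KF : Type) [Fintype KP] [Nonempty KP] [Fintype KF] [Nonempty KF] :
    PMF (KP × KP × KF) :=
  (PMF.uniformOfFintype KP).bind fun k₁ => (PMF.uniformOfFintype KP).bind fun k₂ =>
    (PMF.uniformOfFintype KF).map fun kf => (k₁, k₂, kf)

theorem mem_support_keyDist (k : KP × KP × KF) : k ∈ (keyDist KP KF).support := by
  simp only [keyDist, PMF.mem_support_bind_iff, PMF.mem_support_map_iff,
    PMF.mem_support_uniformOfFintype, true_and]
  exact ⟨k.1, k.2.1, k.2.2, rfl⟩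

/-- All draws are independent, so the input may be drawn last; the dictionary bound is a sum over
inputs for fixed keys. -/
theorem serverExperiment_eq (H : List Bool → M) (A : ServerAdversary U M KP KF KE) :
    Φ.serverExperiment H A = (PMF.uniformOfFintype KE).bind fun ke =>
      (keyDist KP KF).bind fun k => Φ.inputDist.bind fun x => Φ.trial H A ke k x := by
  have h : Φ.serverExperiment H A = Φ.inputDist.bind fun x => (keyDist KP KF).bind fun k =>
      (PMF.uniformOfFintype KE).bind fun ke => Φ.trial H A ke k x := by
    simp only [keyDist, PMF.bind_bind, PMF.bind_map]
    unfold serverExperiment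
    change PMF.bind _ _ = _
    refine congrArg _ (funext fun x => ?_)
    change PMF.bind _ _ = _
    refine congrArg _ (funext fun k₁ => ?_)
    change PMF.bind _ _ = _
    refine congrArg _ (funext fun k₂ => ?_)
    change PMF.bind _ _ = _
    refine congrArg _ (funext fun kf => ?_)
    change PMF.bind _ _ = PMF.bind _ _
    refine congrArg _ (funext fun ke => ?_)
    by_cases hb : Φ.Blocked ke (Φ.embed ke x)
    · simp [testAndCommit, embedAndMap, hb, trial]
    -- The permutations cancel, so the value released to the server is exactly `token`.
    · simp only [testAndCommit, embedAndMap, hb, trial, Equiv.symm_apply_apply, if_false]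
      rfl
  rw [h, PMF.bind_comm]
  simp only [PMF.bind_comm Φ.inputDist]
  rw [PMF.bind_comm]

theorem mem_support_serverExperiment {H : List Bool → M} {A : ServerAdversary U M KP KF KE}
    {ke : KE} {k : KP × KP × KF} {x : U} (hx : Φ.inputDist x ≠ 0) {t : ServerTranscript U KE}
    (ht : t ∈ (Φ.trial H A ke k x).support) : t ∈ (Φ.serverExperiment H A).support := by
  rw [serverExperiment_eq]
  simp only [PMF.mem_support_bind_iff]
  exact ⟨ke, PMF.mem_support_uniformOfFintype ke, k, mem_support_keyDist k, x, hx, ht⟩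

/-- Every execution has at most `n` hash queries, and fewer than `n` if the evaluation that checks
the guess is not among them. -/
def GuessBound (n : ℕ) (A : ServerAdversary U M KP KF KE) : Prop :=
  ∀ H : List Bool → M, ∀ r ∈ (Φ.serverExperiment H A).support,
    r.hashQueries.length ≤ n ∧ ∀ u, r.guess = some u →
      Φ.hashInput r.embedKey u ∉ r.hashQueries → r.hashQueries.length < n

theorem ChargedBound.guessBound {q n : ℕ} {A : ServerAdversary U M KP KF KE}
    (h : Φ.ChargedBound q n A) : Φ.GuessBound n A := by
  intro H r hr
  have h' := (h H r hr).2
  unfold chargedHashQueries at h'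
  cases hg : r.guess with
  | none =>
    rw [hg] at h'
    exact ⟨h', by simp⟩
  | some u =>
    simp only [hg] at h'
    refine ⟨by split_ifs at h' <;> omega, fun v hv hn => ?_⟩
    obtain rfl := Option.some.inj hv
    rw [if_neg hn] at h'
    exact h'

/-- The extra unit pays for the unchecked final guess. -/
theorem ExplicitBound.guessBound {q n : ℕ} {A : ServerAdversary U M KP KF KE}
    (h : Φ.ExplicitBound q n A) : Φ.GuessBound (n + 1) A := fun H r hr =>
  ⟨(h H r hr).2.trans (Nat.le_succ _), fun _ _ _ => Nat.lt_succ_of_le (h H r hr).2⟩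

open Classical in
/-- The weight of the client input, restricted to inputs that are not blocked. -/
def acceptedWeight (ke : KE) (x : U) : ℝ≥0∞ :=
  if Φ.Blocked ke (Φ.embed ke x) then 0 else Φ.inputDist x

theorem tsum_acceptedWeight (ke : KE) : ∑' x, Φ.acceptedWeight ke x = Φ.acceptProb ke := by
  classical
  rw [acceptProb, PMF.toOuterMeasure_apply]
  refine tsum_congr fun x => ?_
  by_cases h : Φ.Blocked ke (Φ.embed ke x) <;> simp [acceptedWeight, Set.indicator, h]

theorem acceptProb_ne_top (ke : KE) : Φ.acceptProb ke ≠ ∞ :=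
  ((PMF.toOuterMeasure_apply_le_one _ _).trans_lt ENNReal.one_lt_top).ne

theorem acceptedWeight_eq (ke : KE) (x : U) :
    Φ.acceptedWeight ke x = Φ.acceptProb ke * Φ.posterior ke x := by
  change _ = Φ.acceptProb ke * (Φ.acceptedWeight ke x / Φ.acceptProb ke)
  -- If acceptance is impossible, the division cannot be undone, but all accepted weights vanish.
  by_cases h : Φ.acceptProb ke = 0
  · rw [h, zero_mul]
    rw [← tsum_acceptedWeight, ENNReal.tsum_eq_zero] at h
    exact h x
  · rw [ENNReal.mul_div_cancel h (Φ.acceptProb_ne_top ke)]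

theorem tsum_posterior_ne_top (ke : KE) : ∑' x, Φ.posterior ke x ≠ ∞ := by
  change ∑' x, Φ.acceptedWeight ke x / Φ.acceptProb ke ≠ ∞
  simp only [div_eq_mul_inv]
  rw [ENNReal.tsum_mul_right, tsum_acceptedWeight, ← div_eq_mul_inv]
  exact (ENNReal.div_self_le_one.trans_lt ENNReal.one_lt_top).ne

theorem bestGuessWeight_acceptedWeight_le (ke : KE) (n : ℕ) :
    bestGuessWeight (Φ.acceptedWeight ke) n ≤ Φ.acceptProb ke * Φ.guessProbAt ke n := by
  refine iSup₂_le fun S hS => ?_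
  simp only [acceptedWeight_eq, ← Finset.mul_sum]
  gcongr
  exact sum_le_greedyGuessProb (Φ.tsum_posterior_ne_top ke) n S hS

/-! ### Averaging over the random oracle and the keys. -/

variable [Fintype M] [MeasurableSpace M]

theorem prob_eq_tsum (A : ServerAdversary U M KP KF KE) {E : Set (ServerTranscript U KE)}
    (hE : ∀ ke k x, Measurable fun H => (Φ.trial H A ke k x).toOuterMeasure E) :
    Φ.prob A E = ∑' ke, PMF.uniformOfFintype KE ke * ∑' k, keyDist KP KF k *
      ∑' x, Φ.inputDist x * ∫⁻ H, (Φ.trial H A ke k x).toOuterMeasure E ∂(randomOracle M) := by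
  have := Φ.countable_input
  have h1 : ∀ ke k, Measurable fun H =>
      ∑' x, Φ.inputDist x * (Φ.trial H A ke k x).toOuterMeasure E := fun ke k =>
    Measurable.tsum fun x => (hE ke k x).const_mul _
  have h2 : ∀ ke, Measurable fun H => ∑' k, keyDist KP KF k *
      ∑' x, Φ.inputDist x * (Φ.trial H A ke k x).toOuterMeasure E := fun ke =>
    Measurable.tsum fun k => (h1 ke k).const_mul _
  simp only [prob, serverExperiment_eq, PMF.toOuterMeasure_bind_apply]
  rw [lintegral_tsum fun ke => ((h2 ke).const_mul _).aemeasurable]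
  refine tsum_congr fun ke => ?_
  rw [lintegral_const_mul _ (h2 ke), lintegral_tsum fun k => ((h1 ke k).const_mul _).aemeasurable]
  congr 1
  refine tsum_congr fun k => ?_
  rw [lintegral_const_mul _ (h1 ke k),
    lintegral_tsum fun x => ((hE ke k x).const_mul _).aemeasurable]
  congr 1
  exact tsum_congr fun x => lintegral_const_mul _ (hE ke k x)

open Classical in
theorem prob_acceptEvent (A : ServerAdversary U M KP KF KE) (K : Set KE) :
    Φ.prob A (acceptEvent U K) =
      ∑ ke, PMF.uniformOfFintype KE ke * if ke ∈ K then Φ.acceptProb ke else 0 := by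
  have : IsProbabilityMeasure (randomOracle M) := by unfold randomOracle; infer_instance
  rw [prob_eq_tsum Φ A fun ke k x => by simp only [trial_acceptEvent, measurable_const],
    tsum_fintype]
  refine Finset.sum_congr rfl fun ke _ => ?_
  congr 1
  simp only [trial_acceptEvent, lintegral_const, measure_univ, mul_one]
  rw [ENNReal.tsum_mul_right, PMF.tsum_coe, one_mul]
  split_ifs with hk
  · rw [← tsum_acceptedWeight]
    exact tsum_congr fun x => by simp [acceptedWeight]
  · simp

variable [DiscreteMeasurableSpace M]

/-- The algorithm itself depends on `H` through the token, so joint measurability in token and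
oracle is needed; it follows from countability of `M`. -/
theorem measurable_token_run (A : ServerAdversary U M KP KF KE) (ke : KE) (k : KP × KP × KF)
    (x : U) (T : Set (U × List (List Bool))) : Measurable fun H : List Bool → M =>
      ((A.combined (Φ.token H ke x) k ke).run H).toOuterMeasure T := by
  have h : Measurable fun z : M × (List Bool → M) =>
      ((A.combined z.1 k ke).run z.2).toOuterMeasure T := by
    refine measurable_from_prod_countable_right fun y => ?_
    exact OracleAlg.measurable_run_toOuterMeasure (A.combined y k ke) T
  have ht : Measurable fun H : List Bool → M => Φ.token H ke x :=
    (measurable_of_countable fun m => Φ.embed ke x + m).comp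
      (measurable_pi_apply (Φ.hashInput ke x))
  exact h.comp (ht.prodMk measurable_id)

theorem measurable_trial_winEvent (A : ServerAdversary U M KP KF KE) (ke : KE)
    (k : KP × KP × KF) (x : U) (K : Set KE) :
    Measurable fun H => (Φ.trial H A ke k x).toOuterMeasure (winEvent U K) := by
  simp only [trial_winEvent]
  split_ifs
  · exact measurable_const
  · exact Φ.measurable_token_run A ke k x _
  · exact measurable_const

/-- For fixed keys, the hash value at the correct input is masked by the token, so that the server
is reduced to a dictionary attack. -/
theorem tsum_lintegral_run_le {n : ℕ} {A : ServerAdversary U M KP KF KE}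
    (hA : Φ.GuessBound n A) (ke : KE) (k : KP × KP × KF) :
    ∑' x, Φ.acceptedWeight ke x * ∫⁻ H,
        ((A.combined (Φ.token H ke x) k ke).run H).toOuterMeasure {r | r.1 = x}
          ∂(randomOracle M) ≤ bestGuessWeight (Φ.acceptedWeight ke) n := by
  have := Φ.countable_input
  have : IsProbabilityMeasure (randomOracle M) := by unfold randomOracle; infer_instance
  have hmeas : ∀ y x, Measurable fun G : List Bool → M =>
      ((A.combined y k ke).run
        (Function.update G (Φ.hashInput ke x) (y - Φ.embed ke x))).toOuterMeasure
          {r | r.1 = x} := fun y x =>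
    (OracleAlg.measurable_run_toOuterMeasure _ _).comp
      (by fun_prop : Measurable fun G : List Bool → M =>
        Function.update G (Φ.hashInput ke x) (y - Φ.embed ke x))
  calc _ = ∑' x, ∑ y, PMF.uniformOfFintype M y * ∫⁻ G, Φ.acceptedWeight ke x *
          ((A.combined y k ke).run
            (Function.update G (Φ.hashInput ke x) (y - Φ.embed ke x))).toOuterMeasure
              {r | r.1 = x} ∂(randomOracle M) := by
        refine tsum_congr fun x => ?_
        rw [show (∫⁻ H, ((A.combined (Φ.token H ke x) k ke).run H).toOuterMeasure {r | r.1 = x}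
          ∂(randomOracle M)) = _ from lintegral_randomOracle_resample (Φ.hashInput ke x)
            (Φ.embed ke x) (f := fun y H =>
              ((A.combined y k ke).run H).toOuterMeasure {r | r.1 = x})
            (fun y => OracleAlg.measurable_run_toOuterMeasure _ _), Finset.mul_sum]
        refine Finset.sum_congr rfl fun y _ => ?_
        rw [lintegral_const_mul _ (hmeas y x), mul_left_comm]
    -- After resampling, the laws of `y` and `G` no longer involve `x`, so the sum over `x` can move
    -- inside and be bounded for each fixed `y` and `G`.
    _ = ∑ y, PMF.uniformOfFintype M y * ∫⁻ G, ∑' x, Φ.acceptedWeight ke x *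
          ((A.combined y k ke).run
            (Function.update G (Φ.hashInput ke x) (y - Φ.embed ke x))).toOuterMeasure
              {r | r.1 = x} ∂(randomOracle M) := by
        rw [Summable.tsum_finsetSum fun _ _ => ENNReal.summable]
        refine Finset.sum_congr rfl fun y _ => ?_
        rw [ENNReal.tsum_mul_left,
          lintegral_tsum fun x => ((hmeas y x).const_mul _).aemeasurable]
    _ ≤ ∑ y, PMF.uniformOfFintype M y * bestGuessWeight (Φ.acceptedWeight ke) n := by
        gcongr with y
        rw [← mul_one (bestGuessWeight _ _), ← measure_univ (μ := randomOracle M),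
          ← lintegral_const]
        refine lintegral_mono fun G => ?_
        refine OracleAlg.tsum_run_le_bestGuessWeight (Φ.hashInput_injective ke) G
          (fun x => y - Φ.embed ke x) _ _ n fun x hx r hr => ?_
        have hb : ¬ Φ.Blocked ke (Φ.embed ke x) := fun hb => hx (if_pos hb)
        have hp : Φ.inputDist x ≠ 0 := by rwa [acceptedWeight, if_neg hb] at hx
        -- The overwritten oracle really produces the token `y`, so these runs occur in the
        -- experiment and obey its query bound.
        have hy : Φ.token (Function.update G (Φ.hashInput ke x) (y - Φ.embed ke x)) ke x = y := by
          simp [token]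
        obtain ⟨t, ht, h1, h2, h3⟩ := Φ.exists_mem_support_trial hb
          (r := r) (A := A) (k := k) (by rwa [hy])
        have := hA _ t (Φ.mem_support_serverExperiment hp ht)
        rw [h1, h2] at this
        exact ⟨this.1, fun hrx => this.2 x (by rw [h3, hrx])⟩
    _ = _ := by
        rw [← Finset.sum_mul, ← tsum_fintype (L := .unconditional _), PMF.tsum_coe, one_mul]

-- Taking `K` to be everything or a single key serves the averaged and the known-key bound at once.
open Classical in
theorem prob_winEvent_le {n : ℕ} {A : ServerAdversary U M KP KF KE} (hA : Φ.GuessBound n A)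
    (K : Set KE) :
    Φ.prob A (winEvent U K) ≤ ∑ ke, PMF.uniformOfFintype KE ke *
      if ke ∈ K then Φ.acceptProb ke * Φ.guessProbAt ke n else 0 := by
  rw [prob_eq_tsum Φ A fun ke k x => Φ.measurable_trial_winEvent A ke k x K, tsum_fintype]
  gcongr with ke
  rw [← one_mul (ite _ _ _), ← (keyDist KP KF).tsum_coe, ← ENNReal.tsum_mul_right]
  gcongr with k
  simp only [trial_winEvent]
  split_ifs with hk
  · refine le_trans (le_of_eq (tsum_congr fun x => ?_)) ((Φ.tsum_lintegral_run_le hA ke k).trans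
      (Φ.bestGuessWeight_acceptedWeight_le ke n))
    by_cases hb : Φ.Blocked ke (Φ.embed ke x) <;> simp [acceptedWeight, hb]
  · simp

theorem winProb_le {n : ℕ} {A : ServerAdversary U M KP KF KE} (hA : Φ.GuessBound n A) :
    Φ.winProb A ≤ Φ.guessProb n := by
  have hw := Φ.prob_winEvent_le hA Set.univ
  have ha := Φ.prob_acceptEvent A Set.univ
  simp only [winEvent, acceptEvent, Set.mem_univ, and_true, if_true, PMF.uniformOfFintype_apply,
    ← Finset.mul_sum] at hw ha
  rw [winProb, ha]
  refine (ENNReal.div_le_div_right hw _).trans (le_of_eq ?_)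
  -- The uniform key probability cancels; what remains weights each key by its posterior given
  -- acceptance.
  rw [ENNReal.mul_div_mul_left _ _ (by simp) (by simp), guessProb, div_eq_mul_inv,
    Finset.sum_mul]
  exact Finset.sum_congr rfl fun ke _ => by rw [div_eq_mul_inv, mul_right_comm]

open Classical in
theorem winProbAt_le {n : ℕ} {A : ServerAdversary U M KP KF KE} (hA : Φ.GuessBound n A)
    (ke : KE) : Φ.winProbAt ke A ≤ Φ.guessProbAt ke n := by
  have hw := Φ.prob_winEvent_le hA {ke}
  have ha := Φ.prob_acceptEvent A {ke}
  have hsum (f : KE → ℝ≥0∞) : (∑ x, if x ∈ ({ke} : Set KE) then f x else 0) = f ke := by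
    exact (Finset.sum_eq_single ke (fun x _ hx => if_neg hx)
      (fun h => absurd (Finset.mem_univ _) h)).trans (if_pos rfl)
  simp only [mul_ite, mul_zero, hsum] at hw ha
  simp only [winEvent, acceptEvent, Set.mem_singleton_iff] at hw ha
  rw [winProbAt, ha]
  refine (ENNReal.div_le_div_right hw _).trans ?_
  rw [← mul_assoc]
  -- This form of division also covers acceptance probability zero.
  exact ENNReal.div_le_of_le_mul (mul_comm _ _).le

end Framework

end

theorem mainTheorem2 {U M KP KF KE : Type} {ell : ℕ}
    [AddCommGroup M] [PseudoMetricSpace M] [Fintype M]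
    [MeasurableSpace M] [DiscreteMeasurableSpace M]
    [Fintype KP] [Nonempty KP] [Fintype KF] [Nonempty KF] [Fintype KE] [Nonempty KE]
    (Φ : Framework U M KP KF KE ell)
    (runTime : ServerAdversary U M KP KF KE → ℕ∞) (t : ℕ∞) (q qH : ℕ) :
    (Φ.advantage {A | runTime A ≤ t ∧ Φ.ChargedBound q qH A} ≤ Φ.guessProb qH ∧
      ∀ ke : KE, Φ.advantageAt ke {A | runTime A ≤ t ∧ Φ.ChargedBound q qH A} ≤
        Φ.guessProbAt ke qH) ∧
    (Φ.advantage {A | runTime A ≤ t ∧ Φ.ExplicitBound q qH A} ≤ Φ.guessProb (qH + 1) ∧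
      ∀ ke : KE, Φ.advantageAt ke {A | runTime A ≤ t ∧ Φ.ExplicitBound q qH A} ≤
        Φ.guessProbAt ke (qH + 1)) :=
  ⟨⟨iSup₂_le fun _ hA => Φ.winProb_le (Framework.ChargedBound.guessBound Φ hA.2),
    fun ke => iSup₂_le fun _ hA =>
      Φ.winProbAt_le (Framework.ChargedBound.guessBound Φ hA.2) ke⟩,
   ⟨iSup₂_le fun _ hA => Φ.winProb_le (Framework.ExplicitBound.guessBound Φ hA.2),
    fun ke => iSup₂_le fun _ hA =>
      Φ.winProbAt_le (Framework.ExplicitBound.guessBound Φ hA.2) ke⟩⟩
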